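/- **Setting.** Let $\mathcal L$ be a geometric lattice, i.e. a finite, atomistic, upper semimodular lattice, with least element $\hat 0$ and greatest element $\hat 1$. Let $\Delta(\mathcal L)$ be the order complex of $\mathcal L\setminus\{\hat 0,\hat 1\}$ (its simplices are the non-empty chains). Let $\mathcal I$ be the set of irreducible elements: those $X>\hat 0$ for which $[\hat 0,X]$ is not isomorphic to a product of two posets with more than one element each. For $X\in\mathcal L$ let $F(X)=\max\{Y\in\mathcal I : Y\le X\}$ be its set of factors. Let $\mathcal N(\mathcal L,\mathcal I)$ be the reduced minimal nested set complex: its simplices are the non-empty sets $S\subseteq\mathcal I\setminus\{\hat 1\}$ such that the join of any two or more pairwise incomparable elements of $S$ does not belong to $\mathcal I\cup\{\hat 1\}$. (If $\hat 1$ is irreducible, then $\mathcal I\cup\{\hat 1\}=\mathcal I$.) For a simplex $\sigma$ of an abstract simplicial complex $K$ and a new vertex $v$, the stellar subdivision $\mathrm{st}(K,\sigma)$ has as simplices the $\tau\in K$ with $\sigma\not\subseteq\tau$, and the sets $\tau\cup\{v\}$ with $\sigma\not\subseteq\tau$ and $\tau\cup\sigma\in K$ ($\tau=\emptyset$ allowed);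 its geometric realization is identified with that of $K$ by the map that is linear on simplices, sends $v$ to the barycenter of $\sigma$ and fixes all other vertices. **Proposition.** Let $X_1,\dots,X_m$ be any listing without repetition of the elements of $\mathcal L\setminus(\mathcal I\cup\{\hat 0,\hat 1\})$ in which no element precedes a larger one. Starting from $\mathcal N(\mathcal L,\mathcal I)$, successive stellar subdivisions in the simplices $F(X_1),\dots,F(X_m)$, with new vertices $X_1,\dots,X_m$, yield $\Delta(\mathcal L)$; in particular, at each step $F(X_i)$ is a simplex and $X_i$ is not a vertex of the complex reached so far. Moreover, for every maximal simplex $c:\ c_1<\dots<c_{r-1}$ of $\Delta(\mathcal L)$, the set $$F(c_1)\cup F(c_2)\cup\dots\cup F(c_{r-1})$$ is a maximal simplex of $\mathcal N(\mathcal L,\mathcal I)$, and it is the simplex supporting $c$: under the resulting identification of the realization of $\Delta(\mathcal L)$ with that of $\mathcal N(\mathcal L,\mathcal I)$, it is the smallest simplex of $\mathcal N(\mathcal L,\mathcal I)$ whose realization contains the realization of $c$. -/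

import Mathlib

namespace NestedSets

/-! ### Simplicial complexes, stellar subdivisions, supports -/

section Complexes

variable {V : Type*}

/-- A maximal simplex of an abstract simplicial complex. -/
def IsMaximalSimplex (K : PreAbstractSimplicialComplex V) (s : Finset V) : Prop :=
  Maximal (fun t => t ∈ K.faces) s

/-- The stellar subdivision of `K` in the simplex `σ`, with new vertex `v`: the simplices containing
`σ` are removed, and the simplices `τ ∪ {v}` are added, for those `τ` (possibly empty) which
do not contain `σ` but for which `τ ∪ σ` is a simplex of `K`. -/
def stellar [DecidableEq V] (K : PreAbstractSimplicialComplex V) (σ : Finset V) (v : V) :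
    PreAbstractSimplicialComplex V where
  faces := {ρ | ρ ∈ K.faces ∧ ¬ σ ⊆ ρ} ∪
    {ρ | ∃ τ : Finset V, ρ = insert v τ ∧ ¬ σ ⊆ τ ∧ τ ∪ σ ∈ K.faces}
  isRelLowerSet_faces := by
    rintro ρ (⟨hρ, hσ⟩ | ⟨τ, rfl, hσ, hτ⟩)
    · exact ⟨(K.isRelLowerSet_faces hρ).1, fun s hs hne =>
        Or.inl ⟨(K.isRelLowerSet_faces hρ).2 hs hne, fun h => hσ (h.trans hs)⟩⟩
    · refine ⟨Finset.insert_nonempty _ _, fun s (hs : s ⊆ insert v τ) hne => ?_⟩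
      by_cases hv : v ∈ s
      · have hsub : s.erase v ⊆ τ := by
          intro x hx
          have := hs (Finset.mem_of_mem_erase hx)
          exact (Finset.mem_insert.1 this).resolve_left (Finset.ne_of_mem_erase hx)
        have hne' : σ.Nonempty := by
          rw [Finset.nonempty_iff_ne_empty]
          rintro rfl
          exact hσ (Finset.empty_subset _)
        refine Or.inr ⟨s.erase v, (Finset.insert_erase hv).symm, fun h => hσ (h.trans hsub), ?_⟩
        exact (K.isRelLowerSet_faces hτ).2 (Finset.union_subset_union_left hsub)
          (hne'.mono Finset.subset_union_right)
      · have hsub : s ⊆ τ := by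
          intro x hx
          refine (Finset.mem_insert.1 (hs hx)).resolve_left ?_
          rintro rfl
          exact hv hx
        exact Or.inl ⟨(K.isRelLowerSet_faces hτ).2 (hsub.trans Finset.subset_union_left) hne,
          fun h => hσ (h.trans hsub)⟩

/-- `IsStellarSequence K l K'`: starting from `K`, one obtains `K'` by performing successively the
stellar subdivisions in `σ` with new vertex `v`, for the entries `(σ, v)` of the list `l`; each
`σ` is required to be a simplex, and each `v` not to be a vertex, of the complex reached so far. -/
inductive IsStellarSequence [DecidableEq V] :
    PreAbstractSimplicialComplex V → List (Finset V × V) → PreAbstractSimplicialComplex V → Prop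
  | nil (K : PreAbstractSimplicialComplex V) : IsStellarSequence K [] K
  | cons (K K' : PreAbstractSimplicialComplex V) (σ : Finset V) (v : V) (l : List (Finset V × V))
      (hσ : σ ∈ K.faces) (hv : {v} ∉ K.faces) (h : IsStellarSequence (stellar K σ v) l K') :
      IsStellarSequence K ((σ, v) :: l) K'

/-- The closed geometric simplex spanned by `s`. The geometric realization of a complex on the
vertex type `V` is the union of these in `V →₀ ℝ`, over its simplices `s`. -/
def geomSimplex (s : Finset V) : Set (V →₀ ℝ) :=
  convexHull ℝ ((fun v => Finsupp.single v (1 : ℝ)) '' (s : Set V))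

/-- The barycenter of the geometric simplex spanned by `s`. -/
noncomputable def barycenter (s : Finset V) : V →₀ ℝ :=
  ∑ u ∈ s, Finsupp.single u ((s.card : ℝ)⁻¹)

/-- The linear map which restricts to the canonical homeomorphism from the realization of
`stellar K σ v` to that of `K`: it sends `v` to the barycenter of `σ` and fixes all other
vertices. -/
noncomputable def stellarMap [DecidableEq V] (σ : Finset V) (v : V) :
    (V →₀ ℝ) →ₗ[ℝ] (V →₀ ℝ) :=
  Finsupp.linearCombination ℝ
    (fun w => if w = v then barycenter σ else Finsupp.single w (1 : ℝ))

/-- The composite of the maps `stellarMap` along a sequence of stellar subdivisions leading from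
`K` to `K'`; it maps the realization of `K'` to that of `K`. -/
noncomputable def subdivisionMap [DecidableEq V] :
    List (Finset V × V) → ((V →₀ ℝ) →ₗ[ℝ] (V →₀ ℝ))
  | [] => LinearMap.id
  | (σ, v) :: l => (stellarMap σ v).comp (subdivisionMap l)

/-- `s` is the simplex of `K` supporting the simplex `c` of a subdivision of `K`, where `f` identifies
the realization of the subdivision with that of `K`: the smallest simplex of `K` whose
realization contains that of `c`. -/
def IsSupportSimplex (K : PreAbstractSimplicialComplex V) (f : (V →₀ ℝ) →ₗ[ℝ] (V →₀ ℝ))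
    (c s : Finset V) : Prop :=
  IsLeast {t : Finset V | t ∈ K.faces ∧ f '' geomSimplex c ⊆ geomSimplex t} s

end Complexes

/-! ### Order complexes, irreducible elements, nested sets -/

section Lattices

universe u

variable (L : Type u) [Lattice L] [BoundedOrder L]

/-- The order complex of the proper part of `L`: its simplices are the non-empty finite chains of
elements different from `⊥` and `⊤`. -/
def orderComplex : PreAbstractSimplicialComplex L where
  faces := {s | s.Nonempty ∧ IsChain (· ≤ ·) (s : Set L) ∧ ∀ x ∈ s, x ≠ ⊥ ∧ x ≠ ⊤}
  isRelLowerSet_faces := by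
    rintro s ⟨hne, hc, hp⟩
    exact ⟨hne, fun t hts ht => ⟨ht, hc.mono (Finset.coe_subset.2 hts), fun x hx => hp x (hts hx)⟩⟩

/-- The irreducible elements of `L`: those `x > ⊥` whose lower interval `[⊥, x]` is not isomorphic
to a product of two partially ordered sets having more than one element each. -/
def irreducibles : Set L :=
  {x | x ≠ ⊥ ∧ ∀ (A B : Type u) [PartialOrder A] [PartialOrder B],
    Nonempty (Set.Iic x ≃o A × B) → Subsingleton A ∨ Subsingleton B}

variable {L}

open scoped Classical in
/-- The set of factors of `x` with respect to `G`: the maximal elements of `G` below `x`. -/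
noncomputable def factors [Fintype L] (G : Set L) (x : L) : Finset L :=
  Finset.univ.filter (fun y => Maximal (fun z => z ∈ G ∧ z ≤ x) y)

/-- `G`-nested sets: subsets of `G` for which the join of any two or more pairwise
incomparable elements does not belong to `G`. -/
def IsNested (G : Set L) (S : Finset L) : Prop :=
  (S : Set L) ⊆ G ∧
    ∀ T ⊆ S, 2 ≤ T.card → IsAntichain (· ≤ ·) (T : Set L) → T.sup id ∉ G

/-- The reduced nested set complex of `L` with respect to a building set `G` containing `⊤`: its
simplices are the non-empty `G`-nested sets which do not contain `⊤`. -/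
def reducedNestedComplex (G : Set L) : PreAbstractSimplicialComplex L where
  faces := {S | S.Nonempty ∧ IsNested G S ∧ ⊤ ∉ S}
  isRelLowerSet_faces := by
    rintro S ⟨hne, ⟨hG, hn⟩, htop⟩
    exact ⟨hne, fun S' hS' hne' => ⟨hne',
      ⟨(Finset.coe_subset.2 hS').trans hG, fun T hT => hn T (hT.trans hS')⟩,
      fun h => htop (hS' h)⟩⟩

end Lattices

end NestedSets

/-! Enlarge the building set from the irreducibles with `⊤` to all non-bottom elements, one
reducible element at a time in the given order. Larger elements are not preceded by smaller ones, so
each stage `G` contains everything above any reducible element it contains (`IsUpperBuilding`).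
Hence, if `x ∉ G`, every element of `G` below `x` is irreducible. Adding `x` is then exactly the
stellar subdivision in `F(x)` (`stellar_eq`), and at the end nested sets are chains.

The lattice input is `sup_filter_le_factor`: if irreducibles join to `x`, those below a factor of
`x` join to that factor. So a nested antichain with join `x ∉ G` contains `F(x)`.

Replacing the new vertex `v` by `σ` turns a maximal simplex of the subdivision into one of the
original complex, and factors of a factor are trivial, so maximality of the union of factors passes
along the sequence. Each vertex `X` of the order complex maps to the barycenter of `F(X)`, and a
simplex containing that point contains `F(X)`; this gives the support. -/

namespace NestedSets

/-! ### Barycenters, supports and maximal simplices under subdivision -/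

section Complexes

variable {V : Type*}

theorem barycenter_apply_of_mem [DecidableEq V] {s : Finset V} {u : V} (hu : u ∈ s) :
    barycenter s u = (s.card : ℝ)⁻¹ := by
  simp [barycenter, Finsupp.finsetSum_apply, Finsupp.single_apply, hu]

theorem barycenter_singleton (v : V) : barycenter {v} = Finsupp.single v (1 : ℝ) := by
  simp [barycenter]

theorem geomSimplex_subset_supported (t : Finset V) :
    geomSimplex t ⊆ (Finsupp.supported ℝ ℝ (t : Set V) : Set (V →₀ ℝ)) := by
  refine convexHull_min ?_ (Submodule.convex _)
  rintro _ ⟨v, hv, rfl⟩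
  exact Finsupp.single_mem_supported ℝ 1 hv

theorem subset_of_barycenter_mem [DecidableEq V] {s t : Finset V}
    (h : barycenter s ∈ geomSimplex t) : s ⊆ t := by
  intro u hu
  have h1 := (Finsupp.mem_supported ℝ _).1 (geomSimplex_subset_supported t h)
  refine Finset.mem_coe.1 (h1 (Finset.mem_coe.2 (Finsupp.mem_support_iff.2 ?_)))
  rw [barycenter_apply_of_mem hu]
  exact inv_ne_zero (Nat.cast_ne_zero.2 (Finset.card_ne_zero_of_mem hu))

theorem barycenter_mem_geomSimplex {s t : Finset V} (hs : s.Nonempty) (h : s ⊆ t) :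
    barycenter s ∈ geomSimplex t := by
  have hc : (s.card : ℝ) ≠ 0 := Nat.cast_ne_zero.2 hs.card_ne_zero
  have : barycenter s = ∑ u ∈ s, (s.card : ℝ)⁻¹ • Finsupp.single u (1 : ℝ) := by
    simp [barycenter]
  rw [this]
  refine (convex_convexHull ℝ _).sum_mem (fun _ _ => by positivity) (by simp [hc]) ?_
  exact fun u hu => subset_convexHull ℝ _ ⟨u, h hu, rfl⟩

variable [DecidableEq V]

theorem stellarMap_single (σ : Finset V) (v w : V) :
    stellarMap σ v (Finsupp.single w 1) =
      if w = v then barycenter σ else Finsupp.single w (1 : ℝ) := by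
  simp [stellarMap]

theorem stellarMap_barycenter_of_notMem (σ : Finset V) {v : V} {s : Finset V} (hv : v ∉ s) :
    stellarMap σ v (barycenter s) = barycenter s := by
  have : barycenter s = ∑ u ∈ s, (s.card : ℝ)⁻¹ • Finsupp.single u (1 : ℝ) := by
    simp [barycenter]
  rw [this, map_sum]
  refine Finset.sum_congr rfl fun u hu => ?_
  rw [map_smul, stellarMap_single, if_neg (ne_of_mem_of_not_mem hu hv)]

/-- No new vertex lies in a simplex being subdivided, so once a vertex is sent to a barycenter, the
remaining maps fix its image. -/
theorem subdivisionMap_single (F : V → Finset V) :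
    ∀ l : List V, (∀ x ∈ l, ∀ y ∈ l, x ∉ F y) → ∀ y,
      subdivisionMap (l.map fun x => (F x, x)) (Finsupp.single y 1) =
        if y ∈ l then barycenter (F y) else Finsupp.single y (1 : ℝ)
  | [], _, y => by simp [subdivisionMap]
  | x :: l, h, y => by
    have ih := subdivisionMap_single F l (fun a ha b hb =>
      h a (List.mem_cons_of_mem _ ha) b (List.mem_cons_of_mem _ hb)) y
    simp only [List.map_cons, subdivisionMap, LinearMap.comp_apply, ih]
    by_cases hy : y ∈ l
    · rw [if_pos hy, if_pos (List.mem_cons_of_mem _ hy), stellarMap_barycenter_of_notMem]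
      exact h x List.mem_cons_self y (List.mem_cons_of_mem _ hy)
    · rw [if_neg hy, stellarMap_single]
      by_cases hyx : y = x
      · subst hyx
        simp
      · simp [hy, hyx]

/-- If `f` maps each vertex of `c` to the barycenter of its set of factors, then the simplex
supporting `c` is the union of these sets. -/
theorem isSupportSimplex_biUnion {K : PreAbstractSimplicialComplex V}
    {f : (V →₀ ℝ) →ₗ[ℝ] (V →₀ ℝ)} {F : V → Finset V} {c : Finset V}
    (hf : ∀ x ∈ c, f (Finsupp.single x 1) = barycenter (F x)) (hF : ∀ x ∈ c, (F x).Nonempty)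
    (hK : c.biUnion F ∈ K.faces) : IsSupportSimplex K f c (c.biUnion F) := by
  refine ⟨⟨hK, ?_⟩, ?_⟩
  · rw [geomSimplex, LinearMap.image_convexHull]
    refine convexHull_min ?_ (convex_convexHull ℝ _)
    rintro _ ⟨_, ⟨x, hx, rfl⟩, rfl⟩
    rw [hf x hx]
    exact barycenter_mem_geomSimplex (hF x hx) (Finset.subset_biUnion_of_mem F hx)
  · rintro t ⟨-, ht⟩
    refine Finset.biUnion_subset.2 fun x hx => subset_of_barycenter_mem ?_
    rw [← hf x hx]
    exact ht ⟨_, subset_convexHull ℝ _ ⟨x, hx, rfl⟩, rfl⟩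

theorem IsMaximalSimplex.of_stellar_of_notMem {K : PreAbstractSimplicialComplex V}
    {σ : Finset V} {v : V} {s : Finset V} (hs : IsMaximalSimplex (stellar K σ v) s)
    (hvs : v ∉ s) : IsMaximalSimplex K s := by
  have hmem : s ∈ K.faces ∧ ¬ σ ⊆ s := by
    rcases hs.prop with h | ⟨τ, rfl, -, -⟩
    · exact h
    · exact absurd (Finset.mem_insert_self _ _) hvs
  refine ⟨hmem.1, fun t ht (hst : s ⊆ t) => ?_⟩
  by_cases hσ : σ ⊆ t
  -- Were `σ ⊆ t`, the vertex `v` could be added to `s`, against maximality.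
  · have : insert v s ∈ (stellar K σ v).faces :=
      Or.inr ⟨s, rfl, hmem.2, (K.isRelLowerSet_faces ht).2 (Finset.union_subset hst hσ)
        ((K.isRelLowerSet_faces hmem.1).1.mono Finset.subset_union_left)⟩
    exact absurd (hs.le_of_ge this (Finset.subset_insert _ _) (Finset.mem_insert_self _ _)) hvs
  · exact hs.le_of_ge (Or.inl ⟨ht, hσ⟩) hst

theorem IsMaximalSimplex.of_stellar_of_mem {K : PreAbstractSimplicialComplex V}
    {σ : Finset V} {v : V} {s : Finset V} (hs : IsMaximalSimplex (stellar K σ v) s)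
    (hv : {v} ∉ K.faces) (hvs : v ∈ s) : IsMaximalSimplex K (s.erase v ∪ σ) := by
  have hK : ∀ t ∈ K.faces, v ∉ t := fun t ht hvt =>
    hv ((K.isRelLowerSet_faces ht).2 (Finset.singleton_subset_iff.2 hvt) ⟨v, by simp⟩)
  have hmem : ¬ σ ⊆ s.erase v ∧ s.erase v ∪ σ ∈ K.faces := by
    rcases hs.prop with h | ⟨τ, rfl, h1, h2⟩
    · exact absurd hvs (hK _ h.1)
    · rw [Finset.erase_insert fun h => hK _ h2 (Finset.mem_union_left _ h)]
      exact ⟨h1, h2⟩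
  refine ⟨hmem.2, fun t ht (hst : s.erase v ∪ σ ⊆ t) w hw => ?_⟩
  by_contra hws
  rw [Finset.mem_union, not_or] at hws
  -- Since `w ∉ σ`, adding `w` does not complete `σ`, so `s` could be enlarged by `w` in the
  -- subdivision.
  have hface : insert v (insert w (s.erase v)) ∈ (stellar K σ v).faces := by
    refine Or.inr ⟨_, rfl, fun h => hmem.1 fun u hu => ?_, ?_⟩
    · refine (Finset.mem_insert.1 (h hu)).resolve_left ?_
      rintro rfl
      exact hws.2 hu
    · refine (K.isRelLowerSet_faces ht).2 ?_ ⟨w, by simp⟩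
      rw [Finset.insert_union]
      exact Finset.insert_subset hw hst
  have hle : s ⊆ insert v (insert w (s.erase v)) := fun u hu => by
    by_cases huv : u = v
    · simp [huv]
    · simp [huv, hu]
  have hwmem := hs.le_of_ge hface hle (Finset.mem_insert_of_mem (Finset.mem_insert_self _ _))
  refine hws.1 (Finset.mem_erase.2 ⟨?_, hwmem⟩)
  rintro rfl
  exact hK _ ht hw

end Complexes

/-! ### Maximal elements of a building set below a given element -/

section Factors

variable {L : Type*} [Lattice L] [Fintype L]

theorem mem_factors {G : Set L} {x y : L} :
    y ∈ factors G x ↔ Maximal (fun z => z ∈ G ∧ z ≤ x) y := by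
  simp [factors]

theorem exists_factor_ge {G : Set L} {x z : L} (hz : z ∈ G) (hzx : z ≤ x) :
    ∃ y ∈ factors G x, z ≤ y := by
  obtain ⟨y, hzy, hy⟩ := (Set.toFinite {z | z ∈ G ∧ z ≤ x}).exists_le_maximal ⟨hz, hzx⟩
  exact ⟨y, mem_factors.2 hy, hzy⟩

theorem factors_eq_singleton {G : Set L} {x : L} (hx : x ∈ G) : factors G x = {x} := by
  ext y
  rw [mem_factors, Finset.mem_singleton]
  refine ⟨fun h => h.eq_of_le ⟨hx, le_rfl⟩ h.prop.2, ?_⟩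
  rintro rfl
  exact ⟨⟨hx, le_rfl⟩, fun z hz _ => hz.2⟩

theorem isAntichain_factors (G : Set L) (x : L) :
    IsAntichain (· ≤ ·) (factors G x : Set L) := by
  intro y hy z hz hne hle
  exact hne ((mem_factors.1 hy).eq_of_le (mem_factors.1 hz).prop hle)

end Factors

/-! ### Product decompositions of lower intervals -/

section Irreducibles

universe u

variable {L : Type u} [Lattice L] [BoundedOrder L]

/-- The lower interval of a reducible element is the product of two smaller ones. -/
theorem exists_split {x : L} (hx : x ≠ ⊥) (hxI : x ∉ irreducibles L) :
    ∃ a b : L, a < x ∧ b < x ∧ a ⊔ b = x ∧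
      (∀ u ≤ a, ∀ v ≤ b, u ⊔ v = x → u = a ∧ v = b) ∧
      ∀ z ∈ irreducibles L, z ≤ x → z ≤ a ∨ z ≤ b := by
  simp only [irreducibles, Set.mem_ofPred_eq, not_and, not_forall, not_or] at hxI
  obtain ⟨A, B, _, _, ⟨e⟩, hA, hB⟩ := hxI hx
  obtain ⟨p₁, p₂, hp⟩ : ∃ p₁ p₂, e ⊤ = (p₁, p₂) := ⟨_, _, rfl⟩
  obtain ⟨q₁, q₂, hq⟩ : ∃ q₁ q₂, e ⊥ = (q₁, q₂) := ⟨_, _, rfl⟩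
  have htop (w : A × B) : w ≤ (p₁, p₂) := by
    rw [← hp, ← e.apply_symm_apply w]
    exact e.monotone le_top
  have hbot (w : A × B) : (q₁, q₂) ≤ w := by
    rw [← hq, ← e.apply_symm_apply w]
    exact e.monotone bot_le
  have hA1 (α : A) : q₁ ≤ α ∧ α ≤ p₁ := ⟨(hbot (α, p₂)).1, (htop (α, p₂)).1⟩
  have hB1 (β : B) : q₂ ≤ β ∧ β ≤ p₂ := ⟨(hbot (p₁, β)).2, (htop (p₁, β)).2⟩
  have hpq₁ : p₁ ≠ q₁ := by
    rintro rfl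
    exact hA ⟨fun s t => ((hA1 s).2.antisymm (hA1 s).1).trans ((hA1 t).1.antisymm (hA1 t).2)⟩
  have hpq₂ : p₂ ≠ q₂ := by
    rintro rfl
    exact hB ⟨fun s t => ((hB1 s).2.antisymm (hB1 s).1).trans ((hB1 t).1.antisymm (hB1 t).2)⟩
  -- The two elements are the tops of the coordinate axes of the product; its bounds are transported
  -- from `[⊥, x]`, as `A` and `B` are merely partial orders.
  obtain ⟨a, ha⟩ := e.surjective (p₁, q₂)
  obtain ⟨b, hb⟩ := e.surjective (q₁, p₂)
  refine ⟨a, b, lt_of_le_of_ne a.2 fun h => ?_, lt_of_le_of_ne b.2 fun h => ?_, ?_, ?_, ?_⟩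
  · have : a = ⊤ := Subtype.ext h
    rw [this, hp] at ha
    exact hpq₂ (congrArg Prod.snd ha)
  · have : b = ⊤ := Subtype.ext h
    rw [this, hp] at hb
    exact hpq₁ (congrArg Prod.fst hb)
  · have : a ⊔ b = ⊤ := by
      refine top_le_iff.1 (e.le_iff_le.1 ?_)
      have h1 := e.monotone (le_sup_left : a ≤ a ⊔ b)
      have h2 := e.monotone (le_sup_right : b ≤ a ⊔ b)
      rw [ha] at h1
      rw [hb] at h2
      rw [hp]
      exact ⟨h1.1, h2.2⟩
    exact congrArg Subtype.val this
  · intro u hu v hv huv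
    have hu' : (⟨u, hu.trans a.2⟩ : Set.Iic x) ≤ a := hu
    have hv' : (⟨v, hv.trans b.2⟩ : Set.Iic x) ≤ b := hv
    set u' : Set.Iic x := ⟨u, hu.trans a.2⟩
    set v' : Set.Iic x := ⟨v, hv.trans b.2⟩
    obtain ⟨w, hw⟩ := e.surjective ((e u').1, (e v').2)
    have hu2 := e.monotone hu'
    have hv2 := e.monotone hv'
    rw [ha] at hu2
    rw [hb] at hv2
    have h1 : u' ≤ w := e.le_iff_le.1 (by rw [hw]; exact ⟨le_rfl, hu2.2.trans (hB1 _).1⟩)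
    have h2 : v' ≤ w := e.le_iff_le.1 (by rw [hw]; exact ⟨hv2.1.trans (hA1 _).1, le_rfl⟩)
    have h3 : w = ⊤ := top_le_iff.1 (show x ≤ w.1 from huv.ge.trans (sup_le h1 h2))
    rw [h3, hp, Prod.mk.injEq] at hw
    refine ⟨hu.antisymm ?_, hv.antisymm ?_⟩
    · exact (e.le_iff_le.1 (by rw [ha]; exact ⟨hw.1.le, (hB1 _).1⟩) : a ≤ u')
    · exact (e.le_iff_le.1 (by rw [hb]; exact ⟨(hA1 _).1, hw.2.le⟩) : b ≤ v')
  · intro z hz hzx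
    set z' : Set.Iic x := ⟨z, hzx⟩ with hz'
    -- The interval below `z` splits along the coordinates of `z`, so irreducibility makes one
    -- coordinate minimal.
    have iso : Set.Iic z ≃o Set.Iic (e z').1 × Set.Iic (e z').2 :=
      { toFun := fun w => (⟨(e ⟨w.1, w.2.trans hzx⟩).1,
            (e.monotone (show (⟨w.1, w.2.trans hzx⟩ : Set.Iic x) ≤ z' from w.2)).1⟩,
          ⟨(e ⟨w.1, w.2.trans hzx⟩).2,
            (e.monotone (show (⟨w.1, w.2.trans hzx⟩ : Set.Iic x) ≤ z' from w.2)).2⟩)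
        invFun := fun w => ⟨(e.symm (w.1.1, w.2.1)).1, by
          have : e.symm (w.1.1, w.2.1) ≤ z' := by
            rw [e.symm_apply_le]
            exact ⟨w.1.2, w.2.2⟩
          exact this⟩
        left_inv := fun w => by ext; simp
        right_inv := fun w => Prod.ext
          (Subtype.ext (congrArg Prod.fst (e.apply_symm_apply (w.1.1, w.2.1))))
          (Subtype.ext (congrArg Prod.snd (e.apply_symm_apply (w.1.1, w.2.1))))
        map_rel_iff' := fun {w w'} => by
          have := e.le_iff_le (x := ⟨w.1, w.2.trans hzx⟩) (y := ⟨w'.1, w'.2.trans hzx⟩)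
          exact this }
    rcases hz.2 _ _ ⟨iso⟩ with h | h
    · right
      have h0 : (e z').1 = q₁ := congrArg Subtype.val
        (Subsingleton.elim (⟨_, le_rfl⟩ : Set.Iic (e z').1) ⟨q₁, (hA1 _).1⟩)
      exact (e.le_iff_le.1 (by rw [hb]; exact ⟨h0.le, (hB1 _).2⟩) : z' ≤ b)
    · left
      have h0 : (e z').2 = q₂ := congrArg Subtype.val
        (Subsingleton.elim (⟨_, le_rfl⟩ : Set.Iic (e z').2) ⟨q₂, (hB1 _).1⟩)
      exact (e.le_iff_le.1 (by rw [ha]; exact ⟨(hA1 _).2, h0.le⟩) : z' ≤ a)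

variable [Fintype L]

theorem le_of_irreducibles_le {u : L} (x : L)
    (h : ∀ z ∈ irreducibles L, z ≤ x → z ≤ u) : x ≤ u := by
  induction x using WellFoundedLT.induction with
  | ind x ih =>
    by_cases hx : x = ⊥
    · simp [hx]
    by_cases hxI : x ∈ irreducibles L
    · exact h x hxI le_rfl
    obtain ⟨a, b, ha, hb, hab, -, -⟩ := exists_split hx hxI
    rw [← hab]
    exact sup_le (ih a ha fun z hz hza => h z hz (hza.trans ha.le))
      (ih b hb fun z hz hzb => h z hz (hzb.trans hb.le))

theorem sup_factors_irreducibles (x : L) : (factors (irreducibles L) x).sup id = x := by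
  refine le_antisymm (Finset.sup_le fun y hy => (mem_factors.1 hy).prop.2) ?_
  refine le_of_irreducibles_le x fun z hz hzx => ?_
  obtain ⟨y, hy, hzy⟩ := exists_factor_ge hz hzx
  exact hzy.trans (Finset.le_sup (f := id) hy)

-- Induction along `x = a ⊔ b`: each member of `T` lies below `a` or `b`, and uniqueness of the
-- decomposition forces the two partial joins to be `a` and `b`. A factor of `x` is a factor of one
-- of them.
open scoped Classical in
theorem sup_filter_le_factor (x : L) : ∀ T : Finset L, (T : Set L) ⊆ irreducibles L →
    T.sup id = x → ∀ y ∈ factors (irreducibles L) x, (T.filter (· ≤ y)).sup id = y := by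
  induction x using WellFoundedLT.induction with
  | ind x ih =>
    intro T hT hTx y hy
    have hyx := (mem_factors.1 hy).prop
    have hle : ∀ t ∈ T, t ≤ x := fun t ht => hTx ▸ Finset.le_sup (f := id) ht
    by_cases hxI : x ∈ irreducibles L
    · rw [factors_eq_singleton hxI, Finset.mem_singleton] at hy
      rw [hy, Finset.filter_true_of_mem hle, hTx]
    have hx : x ≠ ⊥ := by
      rintro rfl
      exact hyx.1.1 (le_bot_iff.1 hyx.2)
    obtain ⟨a, b, ha, hb, hab, hinj, hirr⟩ := exists_split hx hxI
    have hsup : (T.filter (· ≤ a)).sup id ⊔ (T.filter (· ≤ b)).sup id = x := by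
      rw [← Finset.sup_union, ← Finset.filter_or,
        Finset.filter_true_of_mem fun t ht => hirr t (hT ht) (hle t ht), hTx]
    obtain ⟨hTa, hTb⟩ := hinj _ (Finset.sup_le fun t ht => (Finset.mem_filter.1 ht).2) _
      (Finset.sup_le fun t ht => (Finset.mem_filter.1 ht).2) hsup
    have key : ∀ d < x, (T.filter (· ≤ d)).sup id = d → y ≤ d →
        (T.filter (· ≤ y)).sup id = y := by
      intro d hd hTd hyd
      have hyF : y ∈ factors (irreducibles L) d := mem_factors.2
        ⟨⟨hyx.1, hyd⟩, fun z hz hyz => (mem_factors.1 hy).le_of_ge ⟨hz.1, hz.2.trans hd.le⟩ hyz⟩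
      have := ih d hd (T.filter (· ≤ d)) (fun t ht => hT (Finset.mem_filter.1 ht).1) hTd y hyF
      rw [Finset.filter_filter] at this
      rwa [Finset.filter_congr fun t _ => (and_iff_right_of_imp fun h => h.trans hyd :
        (t ≤ d ∧ t ≤ y) ↔ t ≤ y)] at this
    rcases hirr y hyx.1 hyx.2 with h | h
    · exact key a ha hTa h
    · exact key b hb hTb h

end Irreducibles

/-! ### Intermediate building sets and single subdivision steps -/

section NestedSteps

universe u

variable {L : Type u} [Lattice L] [BoundedOrder L]

/-- The intermediate building sets: sets of non-bottom elements which contain all irreducible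
elements and, with each reducible element, everything above it. -/
structure IsUpperBuilding (G : Set L) : Prop where
  irreducibles_subset : irreducibles L ⊆ G
  bot_notMem : ⊥ ∉ G
  mem_of_le : ∀ z ∈ G, z ∉ irreducibles L → ∀ x, z ≤ x → x ∈ G

namespace IsUpperBuilding

variable {G : Set L}

theorem irreducible_of_le (hG : IsUpperBuilding G) {x z : L} (hx : x ∉ G) (hz : z ∈ G)
    (hzx : z ≤ x) : z ∈ irreducibles L := by
  by_contra h
  exact hx (hG.mem_of_le z hz h x hzx)

variable [Fintype L]

/-- An antichain in a nested set whose join is not in the building set contains the factors of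
its join. -/
theorem factors_subset (hG : IsUpperBuilding G) {S T : Finset L} (hS : IsNested G S)
    (hT : T ⊆ S) (hanti : IsAntichain (· ≤ ·) (T : Set L)) (hx : T.sup id ∉ G) :
    factors (irreducibles L) (T.sup id) ⊆ T := by
  classical
  intro y hy
  have hTI : (T : Set L) ⊆ irreducibles L := fun t ht =>
    hG.irreducible_of_le hx (hS.1 (hT ht)) (Finset.le_sup (f := id) ht)
  have hsup := sup_filter_le_factor _ T hTI rfl y hy
  have hyI := (mem_factors.1 hy).prop.1
  have hsub : T.filter (· ≤ y) ⊆ T := Finset.filter_subset _ _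
  -- The members of `T` below `y` join to the irreducible `y`, so nestedness allows only one of
  -- them, namely `y`.
  have hcard : ¬ 2 ≤ (T.filter (· ≤ y)).card := fun h =>
    hS.2 _ (hsub.trans hT) h (hanti.subset (Finset.coe_subset.2 hsub))
      (hsup.symm ▸ hG.irreducibles_subset hyI)
  have hne : (T.filter (· ≤ y)).Nonempty := by
    rw [Finset.nonempty_iff_ne_empty]
    intro h
    rw [h, Finset.sup_empty] at hsup
    exact hyI.1 hsup.symm
  have hone : (T.filter (· ≤ y)).card = 1 := by
    have := hne.card_pos
    omega
  obtain ⟨t, ht⟩ := Finset.card_eq_one.1 hone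
  rw [ht, Finset.sup_singleton] at hsup
  have : y ∈ T.filter (· ≤ y) := by
    rw [ht, Finset.mem_singleton]
    exact hsup.symm
  exact hsub this

/-- If the join is in `G`, then `T` is a singleton. Otherwise `w` is irreducible, hence below a
factor of the join, and the factors belong to `T`. -/
theorem exists_ge_of_le_sup (hG : IsUpperBuilding G) {S T : Finset L} (hS : IsNested G S)
    (hT : T ⊆ S) (hanti : IsAntichain (· ≤ ·) (T : Set L)) {w : L} (hw : w ∈ G)
    (hwT : w ≤ T.sup id) : ∃ t ∈ T, w ≤ t := by
  by_cases hx : T.sup id ∈ G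
  · have hcard : ¬ 2 ≤ T.card := fun h => hS.2 T hT h hanti hx
    have hne : T.Nonempty := by
      rw [Finset.nonempty_iff_ne_empty]
      rintro rfl
      exact hG.bot_notMem (by simpa using hx)
    have hone : T.card = 1 := by
      have := hne.card_pos
      omega
    obtain ⟨t, rfl⟩ := Finset.card_eq_one.1 hone
    exact ⟨t, by simp, by simpa using hwT⟩
  · obtain ⟨y, hy, hwy⟩ := exists_factor_ge (hG.irreducible_of_le hx hw hwT) hwT
    exact ⟨y, hG.factors_subset hS hT hanti hx hy, hwy⟩

theorem two_le_card_factors {x : L} (hx : x ≠ ⊥) (hxI : x ∉ irreducibles L) :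
    2 ≤ (factors (irreducibles L) x).card := by
  have hsup := sup_factors_irreducibles x
  by_contra h
  obtain h0 | h1 : (factors (irreducibles L) x).card = 0 ∨
      (factors (irreducibles L) x).card = 1 := by omega
  · rw [Finset.card_eq_zero.1 h0, Finset.sup_empty] at hsup
    exact hx hsup.symm
  · obtain ⟨y, hy⟩ := Finset.card_eq_one.1 h1
    rw [hy, Finset.sup_singleton] at hsup
    have : y ∈ factors (irreducibles L) x := by simp [hy]
    have h2 := (mem_factors.1 this).prop.1
    exact hxI (hsup ▸ h2)

/-- A set which is nested with respect to the larger building set does not contain all factors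
of the new element. -/
theorem not_factors_subset {x : L} (hx : x ≠ ⊥) (hxI : x ∉ irreducibles L) {S : Finset L}
    (hS : IsNested (insert x G) S) : ¬ factors (irreducibles L) x ⊆ S := fun h =>
  hS.2 _ h (two_le_card_factors hx hxI) (isAntichain_factors _ x)
    (by rw [sup_factors_irreducibles]; exact Set.mem_insert _ _)

theorem isNested_insert_iff_of_notMem (hG : IsUpperBuilding G) {x : L} (hx : x ≠ ⊥)
    (hxG : x ∉ G) {S : Finset L} (hxS : x ∉ S) :
    IsNested (insert x G) S ↔ IsNested G S ∧ ¬ factors (irreducibles L) x ⊆ S := by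
  have hxI : x ∉ irreducibles L := fun h => hxG (hG.irreducibles_subset h)
  constructor
  · intro hS
    refine ⟨⟨fun s hs => (Set.mem_insert_iff.1 (hS.1 hs)).resolve_left ?_, fun T hT h2 ha h =>
      hS.2 T hT h2 ha (Set.mem_insert_of_mem _ h)⟩, not_factors_subset hx hxI hS⟩
    rintro rfl
    exact hxS hs
  · rintro ⟨hS, hF⟩
    refine ⟨hS.1.trans (Set.subset_insert _ _), fun T hT h2 ha h => ?_⟩
    rcases Set.mem_insert_iff.1 h with h | h
    · have := hG.factors_subset hS hT ha (h ▸ hxG)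
      rw [h] at this
      exact hF (this.trans hT)
    · exact hS.2 T hT h2 ha h

/-- Both directions exchange `x` and its factors inside an antichain and locate the join with
`exists_ge_of_le_sup`. -/
theorem isNested_insert_insert_iff [DecidableEq L] (hG : IsUpperBuilding G) {x : L}
    (hG' : IsUpperBuilding (insert x G)) (hx : x ≠ ⊥) (hxG : x ∉ G) {τ : Finset L}
    (hxτ : x ∉ τ) :
    IsNested (insert x G) (insert x τ) ↔
      ¬ factors (irreducibles L) x ⊆ τ ∧ IsNested G (τ ∪ factors (irreducibles L) x) := by
  have hxI : x ∉ irreducibles L := fun h => hxG (hG.irreducibles_subset h)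
  constructor
  · intro hS
    refine ⟨fun h => not_factors_subset hx hxI hS (h.trans (Finset.subset_insert _ _)), ?_, ?_⟩
    · intro s hs
      rcases Finset.mem_union.1 (Finset.mem_coe.1 hs) with hsτ | hsF
      · refine (Set.mem_insert_iff.1 (hS.1 (Finset.mem_insert_of_mem hsτ))).resolve_left ?_
        rintro rfl
        exact hxτ hsτ
      · exact hG.irreducibles_subset (mem_factors.1 hsF).prop.1
    · intro T hT h2 ha hW
      by_cases hTτ : T ⊆ τ
      · exact hS.2 T (hTτ.trans (Finset.subset_insert _ _)) h2 ha (Set.mem_insert_of_mem _ hW)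
      obtain ⟨y, hyT, hyτ⟩ := Finset.not_subset.1 hTτ
      have hyF := (Finset.mem_union.1 (hT hyT)).resolve_left hyτ
      have hyx := (mem_factors.1 hyF).prop.2
      classical
      -- Replace the members of `T` below `x` by `x` itself: this antichain lies in `insert x τ`,
      -- and its join is at least that of `T`.
      set T₂ := T.filter (fun t => ¬ t ≤ x) with hT₂
      have hT₂τ : T₂ ⊆ τ := by
        intro t ht
        rw [hT₂, Finset.mem_filter] at ht
        refine (Finset.mem_union.1 (hT ht.1)).resolve_right fun h => ht.2 ?_
        exact (mem_factors.1 h).prop.2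
      have hxT₂ : ∀ t ∈ T₂, ¬ x ≤ t := by
        intro t ht hxt
        rw [hT₂, Finset.mem_filter] at ht
        have : y = t := ha.eq hyT ht.1 (hyx.trans hxt)
        exact ht.2 (this ▸ hyx)
      have ha' : IsAntichain (· ≤ ·) ((insert x T₂ : Finset L) : Set L) := by
        rw [Finset.coe_insert]
        refine (ha.subset (Finset.coe_subset.2 (Finset.filter_subset _ _))).insert ?_ ?_
        · exact fun t ht _ h => (Finset.mem_filter.1 ht).2 h
        · exact fun t ht _ h => hxT₂ t ht h
      have hle : T.sup id ≤ (insert x T₂).sup id := by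
        refine Finset.sup_le fun t ht => ?_
        by_cases htx : t ≤ x
        · exact htx.trans (Finset.le_sup (f := id) (Finset.mem_insert_self _ _))
        · exact Finset.le_sup (f := id)
            (Finset.mem_insert_of_mem (Finset.mem_filter.2 ⟨ht, htx⟩))
      obtain ⟨t, ht, hWt⟩ := hG'.exists_ge_of_le_sup hS
        (Finset.insert_subset_insert x hT₂τ) ha' (Set.mem_insert_of_mem _ hW) hle
      rcases Finset.mem_insert.1 ht with rfl | ht
      -- If the join of `T` is below `x`, it is irreducible, so below one factor. That factor must
      -- be `y ∈ T`, which then dominates the whole antichain.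
      · obtain ⟨y', hy', hWy'⟩ := exists_factor_ge (hG.irreducible_of_le hxG hW hWt) hWt
        have hyy' : y = y' := (mem_factors.1 hyF).eq_of_le (mem_factors.1 hy').prop
          ((Finset.le_sup (f := id) hyT).trans hWy')
        obtain ⟨s, hs, hsy⟩ := Finset.exists_mem_ne (by omega : 1 < T.card) y
        refine hsy (ha.eq hs hyT ?_)
        exact hyy' ▸ (Finset.le_sup (f := id) hs).trans hWy'
      · have ht' := Finset.mem_filter.1 ht
        have : y = t := ha.eq hyT ht'.1 ((Finset.le_sup (f := id) hyT).trans hWt)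
        exact ht'.2 (this ▸ hyx)
  · rintro ⟨hF, hS⟩
    refine ⟨?_, fun T hT h2 ha hW => ?_⟩
    · rw [Finset.coe_insert]
      exact Set.insert_subset_insert fun t ht => hS.1 (Finset.mem_union_left _ ht)
    by_cases hxT : x ∈ T
    · have hlt : ∀ t ∈ T, t ≠ x → ¬ t ≤ x ∧ ¬ x ≤ t := fun t ht hne =>
        ⟨ha ht hxT hne, ha hxT ht hne.symm⟩
      have hWx : T.sup id ≠ x := by
        intro h
        obtain ⟨s, hs, hsx⟩ := Finset.exists_mem_ne (by omega : 1 < T.card) x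
        exact (hlt s hs hsx).1 (h ▸ Finset.le_sup (f := id) hs)
      have hWG := (Set.mem_insert_iff.1 hW).resolve_left hWx
      classical
      -- Replace `x` by its factors and keep the maximal elements: an antichain with the same join
      -- as `T`. A member above this join is above `x`, which neither a factor nor another member of
      -- `T` can be.
      set R := T.erase x ∪ factors (irreducibles L) x with hR
      have hRS : R ⊆ τ ∪ factors (irreducibles L) x := by
        refine Finset.union_subset_union_left fun t ht => ?_
        exact (Finset.mem_insert.1 (hT (Finset.mem_of_mem_erase ht))).resolve_left
          (Finset.ne_of_mem_erase ht)
      set M := R.filter (fun t => Maximal (· ∈ R) t) with hM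
      have hMR : M ⊆ R := Finset.filter_subset _ _
      have hMa : IsAntichain (· ≤ ·) (M : Set L) := by
        intro s hs t ht hne hle
        exact hne ((Finset.mem_filter.1 hs).2.eq_of_le (hMR ht) hle)
      have hge : ∀ t ∈ R, t ≤ M.sup id := by
        intro t ht
        obtain ⟨m, htm, hm⟩ := R.finite_toSet.exists_le_maximal (Finset.mem_coe.2 ht)
        exact htm.trans (Finset.le_sup (f := id) (Finset.mem_filter.2 ⟨hm.prop, hm⟩))
      have hxM : x ≤ M.sup id := by
        conv_lhs => rw [← sup_factors_irreducibles x]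
        exact Finset.sup_le fun t ht => hge t (Finset.mem_union_right _ ht)
      have hMsup : M.sup id = T.sup id := by
        refine le_antisymm (Finset.sup_le fun t ht => ?_) (Finset.sup_le fun t ht => ?_)
        · rcases Finset.mem_union.1 (hMR ht) with h | h
          · exact Finset.le_sup (f := id) (Finset.mem_of_mem_erase h)
          · exact (mem_factors.1 h).prop.2.trans (Finset.le_sup (f := id) hxT)
        · by_cases htx : t = x
          · exact htx ▸ hxM
          · exact hge t (Finset.mem_union_left _ (Finset.mem_erase.2 ⟨htx, ht⟩))
      obtain ⟨m, hm, hWm⟩ := hG.exists_ge_of_le_sup hS (hMR.trans hRS) hMa hWG hMsup.ge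
      have hxm : x ≤ m := hxM.trans (hMsup.le.trans hWm)
      rcases Finset.mem_union.1 (hMR hm) with h | h
      · obtain ⟨hne, hmT⟩ := Finset.mem_erase.1 h
        exact (hlt m hmT hne).2 hxm
      · have h' := (mem_factors.1 h).prop
        exact hxI (hxm.antisymm h'.2 ▸ h'.1)
    · have hTτ : T ⊆ τ := fun t ht => (Finset.mem_insert.1 (hT ht)).resolve_left fun h =>
        hxT (h ▸ ht)
      have hτ : IsNested G τ := ⟨fun t ht => hS.1 (Finset.mem_union_left _ ht),
        fun T' hT' => hS.2 T' (hT'.trans Finset.subset_union_left)⟩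
      exact ((hG.isNested_insert_iff_of_notMem hx hxG hxτ).2 ⟨hτ, hF⟩).2 T hTτ h2 ha hW

/-- Adding one reducible element to the building set amounts to one stellar subdivision. -/
theorem stellar_eq [DecidableEq L] (hG : IsUpperBuilding G) {x : L}
    (hG' : IsUpperBuilding (insert x G)) (hx : x ≠ ⊥) (hxtop : x ≠ ⊤) (hxG : x ∉ G) :
    stellar (reducedNestedComplex G) (factors (irreducibles L) x) x =
      reducedNestedComplex (insert x G) := by
  have htopF : ⊤ ∉ factors (irreducibles L) x := fun h =>
    hxtop (top_le_iff.1 (mem_factors.1 h).prop.2)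
  ext S
  constructor
  · rintro (⟨⟨hne, hS, htop⟩, hF⟩ | ⟨τ, rfl, hF, ⟨hne, hS, htop⟩⟩)
    · exact ⟨hne, (hG.isNested_insert_iff_of_notMem hx hxG fun h => hxG (hS.1 h)).2 ⟨hS, hF⟩,
        htop⟩
    · have hxτ : x ∉ τ := fun h => hxG (hS.1 (Finset.mem_union_left _ h))
      refine ⟨Finset.insert_nonempty _ _,
        (hG.isNested_insert_insert_iff hG' hx hxG hxτ).2 ⟨hF, hS⟩, fun h => ?_⟩
      rcases Finset.mem_insert.1 h with h | h
      · exact hxtop h.symm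
      · exact htop (Finset.mem_union_left _ h)
  · rintro ⟨hne, hS, htop⟩
    by_cases hxS : x ∈ S
    · obtain ⟨τ, hxτ, rfl⟩ : ∃ τ, x ∉ τ ∧ insert x τ = S :=
        ⟨S.erase x, Finset.notMem_erase x S, Finset.insert_erase hxS⟩
      obtain ⟨hF, hτ⟩ := (hG.isNested_insert_insert_iff hG' hx hxG hxτ).1 hS
      refine Or.inr ⟨τ, rfl, hF, ?_, hτ, fun h => ?_⟩
      · have hFne : (factors (irreducibles L) x).Nonempty := by
          rw [Finset.nonempty_iff_ne_empty]
          intro h0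
          exact hF (h0 ▸ Finset.empty_subset _)
        exact hFne.mono Finset.subset_union_right
      · rcases Finset.mem_union.1 h with h | h
        · exact htop (Finset.mem_insert_of_mem h)
        · exact htopF h
    · obtain ⟨h1, h2⟩ := (hG.isNested_insert_iff_of_notMem hx hxG hxS).1 hS
      exact Or.inl ⟨⟨hne, h1, htop⟩, h2⟩

theorem factors_mem_faces [DecidableEq L] (hG : IsUpperBuilding G) {x : L}
    (hG' : IsUpperBuilding (insert x G)) (hx : x ≠ ⊥) (hxtop : x ≠ ⊤) (hxG : x ∉ G) :
    factors (irreducibles L) x ∈ (reducedNestedComplex G).faces := by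
  have hxI : x ∉ irreducibles L := fun h => hxG (hG.irreducibles_subset h)
  -- The vertex `x` alone is nested for the larger building set; the equivalence with `τ = ∅` then
  -- shows that its factors are nested for `G`.
  have hnested : IsNested (insert x G) (insert x ∅) := by
    refine ⟨by simp, fun T hT h2 => ?_⟩
    have := Finset.card_le_card hT
    rw [Finset.card_insert_of_notMem (Finset.notMem_empty x), Finset.card_empty] at this
    omega
  have h := ((hG.isNested_insert_insert_iff hG' hx hxG (Finset.notMem_empty x)).1 hnested).2
  rw [Finset.empty_union] at h
  refine ⟨Finset.card_pos.1 (by have := two_le_card_factors hx hxI; omega), h, fun h =>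
    hxtop (top_le_iff.1 (mem_factors.1 h).prop.2)⟩

end IsUpperBuilding

/-- With respect to the set of all non-bottom elements, nested sets are chains. -/
theorem reducedNestedComplex_eq_orderComplex {G : Set L} (hG : ∀ x, x ∈ G ↔ x ≠ ⊥) :
    reducedNestedComplex G = orderComplex L := by
  classical
  ext S
  constructor
  · rintro ⟨hne, hS, htop⟩
    refine ⟨hne, fun s hs t ht hst => ?_, fun s hs => ⟨(hG s).1 (hS.1 hs), fun h => htop (h ▸ hs)⟩⟩
    by_contra hcomp
    rw [not_or] at hcomp
    refine hS.2 {s, t} ?_ (Finset.card_pair hst).ge ?_ ((hG _).2 fun h => ?_)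
    · intro w hw
      rcases Finset.mem_insert.1 hw with rfl | hw
      · exact hs
      · exact Finset.mem_singleton.1 hw ▸ ht
    · intro a ha b hb hab hle
      simp only [Finset.coe_insert, Finset.coe_singleton, Set.mem_insert_iff,
        Set.mem_singleton_iff] at ha hb
      rcases ha with rfl | rfl <;> rcases hb with rfl | rfl <;> tauto
    · rw [Finset.sup_insert, Finset.sup_singleton, sup_eq_bot_iff] at h
      exact (hG s).1 (hS.1 hs) h.1
  · rintro ⟨hne, hS, hpr⟩
    refine ⟨hne, ⟨fun s hs => (hG s).2 (hpr s hs).1, fun T hT h2 ha _ => ?_⟩, fun h =>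
      (hpr _ h).2 rfl⟩
    obtain ⟨a, hat, b, hbt, hab⟩ := Finset.one_lt_card.1 (by omega : 1 < T.card)
    rcases hS (hT hat) (hT hbt) hab with h | h
    · exact ha hat hbt hab h
    · exact ha hbt hat hab.symm h

variable [Fintype L] [DecidableEq L]

/-- The inductive step along the list of reducible elements. The last conclusion transports, from
`G` to the order complex, the fact that the union of the factors of a maximal simplex is a
maximal simplex of `K`. -/
theorem isStellarSequence_of_isUpperBuilding (K : PreAbstractSimplicialComplex L) :
    ∀ (l : List L) (G : Set L), IsUpperBuilding G → ⊤ ∈ G →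
      l.Nodup → (∀ x, x ∈ l ↔ x ≠ ⊥ ∧ x ∉ G) → l.Pairwise (fun x y => ¬ x < y) →
      (∀ S, IsMaximalSimplex (reducedNestedComplex G) S →
        IsMaximalSimplex K (S.biUnion (factors (irreducibles L)))) →
      IsStellarSequence (reducedNestedComplex G)
        (l.map fun x => (factors (irreducibles L) x, x)) (orderComplex L) ∧
      ∀ S, IsMaximalSimplex (orderComplex L) S →
        IsMaximalSimplex K (S.biUnion (factors (irreducibles L)))
  | [], G, hG, _, _, hmem, _, hK => by
    rw [← reducedNestedComplex_eq_orderComplex (G := G) fun x => ?_]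
    · exact ⟨IsStellarSequence.nil _, hK⟩
    · refine ⟨?_, fun hx => by simpa [hx] using hmem x⟩
      rintro hx rfl
      exact hG.bot_notMem hx
  | x :: l, G, hG, htop, hnd, hmem, hord, hK => by
    obtain ⟨hx, hxG⟩ := (hmem x).1 List.mem_cons_self
    have hxtop : x ≠ ⊤ := by
      rintro rfl
      exact hxG htop
    rw [List.nodup_cons] at hnd
    rw [List.pairwise_cons] at hord
    have hG' : IsUpperBuilding (insert x G) := by
      refine ⟨hG.irreducibles_subset.trans (Set.subset_insert _ _), ?_, ?_⟩
      · rintro (h | h)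
        · exact hx h.symm
        · exact hG.bot_notMem h
      · rintro z (rfl | hz) hzI w hzw
        -- An element strictly above the new one and not in `G` would come later in the list,
        -- against the order.
        · by_contra hw
          rw [Set.mem_insert_iff, not_or] at hw
          have hlt : z < w := lt_of_le_of_ne hzw (Ne.symm hw.1)
          have hwl : w ∈ z :: l := (hmem w).2 ⟨(bot_le.trans_lt hlt).ne', hw.2⟩
          exact hord.1 w ((List.mem_cons.1 hwl).resolve_left hw.1) hlt
        · exact Set.mem_insert_of_mem _ (hG.mem_of_le z hz hzI w hzw)
    have hst := hG.stellar_eq hG' hx hxtop hxG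
    have hv : {x} ∉ (reducedNestedComplex G).faces := fun h =>
      hxG (h.2.1.1 (by simp))
    have hmem' : ∀ z, z ∈ l ↔ z ≠ ⊥ ∧ z ∉ insert x G := by
      intro z
      have hz := hmem z
      rw [List.mem_cons] at hz
      rw [Set.mem_insert_iff, not_or]
      constructor
      · intro hzl
        have := hz.1 (Or.inr hzl)
        exact ⟨this.1, fun h => hnd.1 (h ▸ hzl), this.2⟩
      · rintro ⟨h1, h2, h3⟩
        exact (hz.2 ⟨h1, h3⟩).resolve_left h2
    have hK' : ∀ S, IsMaximalSimplex (reducedNestedComplex (insert x G)) S →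
        IsMaximalSimplex K (S.biUnion (factors (irreducibles L))) := by
      intro S hS
      rw [← hst] at hS
      by_cases hxS : x ∈ S
      · have := hK _ (hS.of_stellar_of_mem hv hxS)
        convert this using 1
        -- A factor is its own only factor, so replacing `x` by its factors leaves the union
        -- unchanged.
        have hFF : (factors (irreducibles L) x).biUnion (factors (irreducibles L)) =
            factors (irreducibles L) x := by
          conv_rhs => rw [← Finset.biUnion_singleton_eq_self (s := factors (irreducibles L) x)]
          exact Finset.biUnion_congr rfl fun y hy =>
            factors_eq_singleton (mem_factors.1 hy).prop.1
        rw [Finset.union_biUnion, hFF]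
        conv_lhs => rw [← Finset.insert_erase hxS, Finset.biUnion_insert]
        exact Finset.union_comm _ _
      · exact hK _ (hS.of_stellar_of_notMem hxS)
    obtain ⟨h1, h2⟩ := isStellarSequence_of_isUpperBuilding K l (insert x G) hG'
      (Set.mem_insert_of_mem _ htop) hnd.2 hmem' hord.2 hK'
    exact ⟨IsStellarSequence.cons _ _ _ _ _ (hG.factors_mem_faces hG' hx hxtop hxG) hv
      (hst ▸ h1), h2⟩

end NestedSteps

end NestedSets

/-! ### The proposition -/

theorem mainTheorem6 {L : Type*} [Lattice L] [BoundedOrder L] [Fintype L] [DecidableEq L]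
    [IsAtomistic L] [IsUpperModularLattice L]
    (g : List L) (hg_nodup : g.Nodup)
    (hg_mem : ∀ X : L, X ∈ g ↔ X ≠ ⊥ ∧ X ≠ ⊤ ∧ X ∉ NestedSets.irreducibles L)
    (hg_order : g.Pairwise (fun X Y => ¬ X < Y)) :
    NestedSets.IsStellarSequence
      (NestedSets.reducedNestedComplex (insert ⊤ (NestedSets.irreducibles L)))
      (g.map (fun X => (NestedSets.factors (NestedSets.irreducibles L) X, X)))
      (NestedSets.orderComplex L) ∧
    ∀ c : Finset L, NestedSets.IsMaximalSimplex (NestedSets.orderComplex L) c →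
      NestedSets.IsMaximalSimplex
        (NestedSets.reducedNestedComplex (insert ⊤ (NestedSets.irreducibles L)))
        (c.biUnion (NestedSets.factors (NestedSets.irreducibles L))) ∧
      NestedSets.IsSupportSimplex
        (NestedSets.reducedNestedComplex (insert ⊤ (NestedSets.irreducibles L)))
        (NestedSets.subdivisionMap
          (g.map (fun X => (NestedSets.factors (NestedSets.irreducibles L) X, X))))
        c (c.biUnion (NestedSets.factors (NestedSets.irreducibles L))) := by
  classical
  have hbot : (⊥ : L) ∉ NestedSets.irreducibles L := fun h => h.1 rfl
  -- In the one-element lattice the initial building set would contain `⊥`; there both complexes are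
  -- empty.
  by_cases htriv : (⊤ : L) = ⊥
  · have hall : ∀ x : L, x = ⊥ := fun x => le_bot_iff.1 (htriv ▸ le_top)
    have hg : g = [] := List.eq_nil_iff_forall_not_mem.2 fun x hx =>
      ((hg_mem x).1 hx).1 (hall x)
    have hK : NestedSets.reducedNestedComplex (insert ⊤ (NestedSets.irreducibles L)) =
        NestedSets.orderComplex L := by
      ext S
      constructor
      · rintro ⟨⟨s, hs⟩, -, htop⟩
        exact absurd (htriv ▸ hall s ▸ hs) htop
      · rintro ⟨⟨s, hs⟩, -, hpr⟩
        exact absurd (hall s) (hpr s hs).1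
    subst hg
    refine ⟨hK ▸ NestedSets.IsStellarSequence.nil _, fun c hc => ?_⟩
    obtain ⟨⟨s, hs⟩, -, hpr⟩ := hc.prop
    exact absurd (hall s) (hpr s hs).1
  have hG : NestedSets.IsUpperBuilding (insert ⊤ (NestedSets.irreducibles L)) := by
    refine ⟨Set.subset_insert _ _, ?_, ?_⟩
    · rintro (h | h)
      · exact htriv h.symm
      · exact hbot h
    · rintro z (rfl | hz) hzI x hzx
      · exact Or.inl (top_le_iff.1 hzx)
      · exact absurd hz hzI
  obtain ⟨h1, h2⟩ := NestedSets.isStellarSequence_of_isUpperBuilding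
    (NestedSets.reducedNestedComplex (insert ⊤ (NestedSets.irreducibles L))) g _ hG
    (Set.mem_insert _ _) hg_nodup
    (fun x => by rw [hg_mem, Set.mem_insert_iff, not_or]) hg_order (fun S hS => by
      -- Initially all vertices are irreducible, so the union of factors is the simplex itself.
      have : S.biUnion (NestedSets.factors (NestedSets.irreducibles L)) = S := by
        conv_rhs => rw [← Finset.biUnion_singleton_eq_self (s := S)]
        refine Finset.biUnion_congr rfl fun y hy => NestedSets.factors_eq_singleton ?_
        refine (Set.mem_insert_iff.1 (hS.prop.2.1.1 hy)).resolve_left ?_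
        rintro rfl
        exact hS.prop.2.2 hy
      rwa [this])
  refine ⟨h1, fun c hc => ⟨h2 c hc, ?_⟩⟩
  refine NestedSets.isSupportSimplex_biUnion (fun x hx => ?_) (fun x hx => ?_) (h2 c hc).prop
  · rw [NestedSets.subdivisionMap_single]
    · split_ifs with hxg
      · rfl
      · have hpr := hc.prop.2.2 x hx
        have hxI : x ∈ NestedSets.irreducibles L := by
          by_contra h
          exact hxg ((hg_mem x).2 ⟨hpr.1, hpr.2, h⟩)
        rw [NestedSets.factors_eq_singleton hxI, NestedSets.barycenter_singleton]
    · intro y hy z _ h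
      exact ((hg_mem y).1 hy).2.2 (NestedSets.mem_factors.1 h).prop.1
  · rw [Finset.nonempty_iff_ne_empty]
    intro h
    have hsup := NestedSets.sup_factors_irreducibles x
    rw [h, Finset.sup_empty] at hsup
    exact (hc.prop.2.2 x hx).1 hsup.symm
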